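/- \textbf{Theorem 1 (First Visit Time Lemma).} For every $n$ let $\mathcal X=\mathcal X^{(n)}$ be a set of $n$ states, and for all sufficiently large $n$ let $P=P^{(n)}$ be an ergodic (irreducible and aperiodic) transition matrix on $\mathcal X$ with stationary distribution $\pi=\pi^{(n)}$. For $x\in\mathcal X$ let $[P]_x$ be the matrix obtained from $P$ by removing the row and the column of $x$; assume that $[P]_x$ is irreducible for every $x\in\mathcal X$, and let $\lambda_x$ be its leading (Perron) eigenvalue. Assume that there are a real number $c>2$ and integers $T=T(n)\ge 0$ with $T(n)\to\infty$ such that, as $n\to\infty$, (HP1) $\max_{x,y\in\mathcal X}|P^T(x,y)-\pi(y)|=o(n^{-c})$; (HP2) $T\max_{x\in\mathcal X}\pi(x)=o(1)$; (HP3) $\min_{x\in\mathcal X}\pi(x)=\omega(n^{-2})$. Let $\tau_x=\inf\{t\ge 0: X_t=x\}$ be the hitting time of $x$, let $\mathbb P_\pi$ be the law of the chain $(X_t)_{t\ge0}$ with transition matrix $P$ and initial distribution $\pi$, and let $R_T(x)=\sum_{t=0}^{T}P^t(x,x)$ be the expected number of visits to $x$ in the times $0,\dots,T$ of the chain started at $x$.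 Then, as $n\to\infty$, uniformly in $x\in\mathcal X$, $$\sup_{t\ge 0}\left|\frac{\mathbb P_\pi(\tau_x>t)}{\lambda_x^t}-1\right|\longrightarrow 0 \qquad\text{and}\qquad \left|\frac{\lambda_x}{1-\pi(x)/R_T(x)}-1\right|\longrightarrow 0 .$$ -/

import Mathlib

open Filter Asymptotics MeasureTheory Topology

/-- A finite-state transition matrix is ergodic: irreducible and aperiodic, i.e. for every state
the greatest common divisor of the possible (positive) return times is `1`. -/
structure IsErgodic {S : Type*} [Fintype S] [DecidableEq S] (P : Matrix S S ℝ) : Prop where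
  irreducible : P.IsIrreducible
  aperiodic : ∀ x : S, ∀ d : ℕ, (∀ k : ℕ, 0 < k → 0 < (P ^ k) x x → d ∣ k) → d = 1

/-- `π` is a stationary probability distribution of the transition matrix `P`. -/
structure IsStationaryDistribution {S : Type*} [Fintype S] (P : Matrix S S ℝ) (π : S → ℝ) : Prop where
  mem_stdSimplex : π ∈ stdSimplex ℝ S
  invariant : Matrix.vecMul π P = π

/-- Under the probability measure `Pr`, the process `X` is a (time-homogeneous, discrete-time)
Markov chain with initial distribution `α` and transition matrix `P`: given the whole past up to
time `t`, the next state is drawn from the row `P (X t) ·`. -/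
structure IsMarkovChain {Ω S : Type*} [MeasurableSpace Ω] (Pr : Measure Ω) (X : ℕ → Ω → S)
    (α : S → ℝ) (P : Matrix S S ℝ) : Prop where
  isProbabilityMeasure : IsProbabilityMeasure Pr
  measurableSet_eq : ∀ (t : ℕ) (y : S), MeasurableSet {ω | X t ω = y}
  initial : ∀ y : S, Pr.real {ω | X 0 ω = y} = α y
  step : ∀ (t : ℕ) (p : ℕ → S),
    Pr.real {ω | ∀ s ≤ t + 1, X s ω = p s} =
      Pr.real {ω | ∀ s ≤ t, X s ω = p s} * P (p t) (p (t + 1))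

/-- The hitting time `inf {t ≥ 0 | X t = x}`, equal to `⊤` if `x` is never visited. -/
noncomputable def hitTime {Ω S : Type*} (X : ℕ → Ω → S) (x : S) : Ω → WithTop ℕ :=
  hittingAfter X {x} 0

/-- The sub-Markovian kernel obtained from `P` by removing the row and the column of `x`. -/
def killed {S : Type*} (P : Matrix S S ℝ) (x : S) : Matrix {y : S // y ≠ x} {y : S // y ≠ x} ℝ :=
  P.submatrix Subtype.val Subtype.val

/-- The leading (Perron) eigenvalue of a nonnegative square matrix: its spectral radius, i.e. the
largest modulus of its complex eigenvalues. -/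
noncomputable def leadingEigenvalue {S : Type*} [Fintype S] [DecidableEq S]
    (A : Matrix S S ℝ) : ℝ :=
  (spectralRadius ℂ (A.map Complex.ofReal)).toReal

/-- The expected number of returns to `x` within time `T` of the chain started at `x` (the visit at
time `0` included): `∑_{t=0}^{T} P^t(x,x)`. -/
def expectedReturns {S : Type*} [Fintype S] [DecidableEq S] (P : Matrix S S ℝ) (T : ℕ) (x : S) :
    ℝ :=
  ∑ t ∈ Finset.range (T + 1), (P ^ t) x x

/-!
Fix `n`, a state `x`, and write `Q` for the kernel killed at `x`, `r` for its leading eigenvalue,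
`p` for the restriction of the stationary distribution to the other states, and
`a t = p ⬝ᵥ (Q ^ t *ᵥ 1)` for the survival probability `ℙ_π(τ_x > t)`
(`IsMarkovChain.measureReal_lt_hitTime`). The proof compares `p` with the quasi-stationary
distribution `μ`, the Perron left eigenvector of `Q`, from which survival is exactly geometric:
`μ ⬝ᵥ (Q ^ t *ᵥ 1) = r ^ t`. Its existence for the spectral radius of an irreducible matrix is
`Matrix.IsIrreducible.exists_leftEigenvector`.

By the mixing hypothesis and the lower bound on `π`, the matrix `P ^ T` is entrywise within a factor
`1 ± δ` of `π`, with `δ → 0`, and `Q ^ T ≤ P ^ T`. Three facts follow.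

* `r ^ T → 1` (`IsFastMixingKilled.rate_pow_ge`). As `(T + 1) π x → 0`, the chain started from `π`
  rarely visits `x` before time `T`, so most states `i` have survival probability `(Q ^ T *ᵥ 1) i` close
  to `1`, and after `T` steps started there the chain is most likely in such a state again.
* `r ^ T • μ = μ Q ^ T ≤ (1 + δ) p`, so `r ^ (t + T) ≤ (1 + δ) a t`
  (`IsFastMixingKilled.rate_pow_add_le`).
* Conversely `r ^ T • μ ≥ (1 - δ) p - ρ` with `ρ` of total mass at most `1 - r ^ T`, which gives
  `(1 - δ) a (t + T) ≤ r ^ (t + 2 T) + (1 - r ^ T) (1 + δ) a t`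
  (`IsFastMixingKilled.recursive_bound`). As the coefficient of `a t` is small, strong induction on
  `t` yields `a t ≤ (1 + o(1)) r ^ t` uniformly in `t`.

The errors depend on `x` only through the uniform bounds in the hypotheses. The approximation of the
eigenvalue follows from `r → 1` and `π x / expectedReturns P T x ≤ π x → 0`.
-/

/-! ### The Perron eigenvector -/

section Perron

variable {D : Type*} [Fintype D] [DecidableEq D]

open Matrix

omit [DecidableEq D] in
lemma vecMul_mono_left {A : Matrix D D ℝ} (hA : ∀ i j, 0 ≤ A i j) {v w : D → ℝ} (h : v ≤ w) :
    v ᵥ* A ≤ w ᵥ* A := fun j =>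
  Finset.sum_le_sum fun i _ => mul_le_mul_of_nonneg_right (h i) (hA i j)

lemma pow_smul_le_vecMul_pow {A : Matrix D D ℝ} (hA : ∀ i j, 0 ≤ A i j) {w : D → ℝ} {s : ℝ}
    (hs : 0 ≤ s) (h : s • w ≤ w ᵥ* A) (k : ℕ) : s ^ k • w ≤ w ᵥ* A ^ k := by
  induction k with
  | zero => simp
  | succ k ih =>
    calc s ^ (k + 1) • w = s ^ k • (s • w) := by rw [smul_smul, pow_succ]
      _ ≤ s ^ k • (w ᵥ* A) := smul_le_smul_of_nonneg_left h (pow_nonneg hs k)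
      _ = (s ^ k • w) ᵥ* A := by rw [smul_vecMul]
      _ ≤ (w ᵥ* A ^ k) ᵥ* A := vecMul_mono_left hA ih
      _ = w ᵥ* A ^ (k + 1) := by rw [vecMul_vecMul, pow_succ]

attribute [local instance] Matrix.linftyOpNormedRing Matrix.linftyOpNormedAlgebra

lemma norm_entry_le_linftyOp (M : Matrix D D ℂ) (i j : D) : ‖M i j‖ ≤ ‖M‖ := by
  have h := Matrix.linfty_opNorm_mulVec M (Pi.single j 1)
  have h2 : ‖(Pi.single j 1 : D → ℂ)‖ ≤ 1 := by
    refine (pi_norm_le_iff_of_nonneg zero_le_one).2 fun a => ?_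
    by_cases ha : a = j
    · subst ha; simp
    · simp [ha]
  have h3 := norm_le_pi_norm (M *ᵥ Pi.single j 1) i
  rw [Matrix.mulVec_single_one] at h3 h
  calc ‖M i j‖ ≤ _ := h3
    _ ≤ _ := h
    _ ≤ ‖M‖ := mul_le_of_le_one_right (norm_nonneg _) h2

/-- The easy half of the Collatz–Wielandt characterization, by Gelfand's formula. -/
lemma le_leadingEigenvalue_of_smul_le_vecMul [Nonempty D] {A : Matrix D D ℝ}
    (hA : ∀ i j, 0 ≤ A i j) {w : D → ℝ} (hw : ∀ i, 0 < w i) {s : ℝ} (hs : 0 ≤ s)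
    (h : s • w ≤ w ᵥ* A) : s ≤ leadingEigenvalue A := by
  obtain ⟨j⟩ := ‹Nonempty D›
  set M : Matrix D D ℂ := A.map Complex.ofReal with hM
  set C : ℝ := (∑ i, w i) / w j with hC
  have hsum : 0 < ∑ i, w i := Finset.sum_pos (fun i _ => hw i) ⟨j, Finset.mem_univ j⟩
  have hC0 : 0 < C := div_pos hsum (hw j)
  have hMk : ∀ k, M ^ k = (A ^ k).map Complex.ofReal := fun k =>
    (Matrix.map_pow A Complex.ofRealHom k).symm
  have hk : ∀ k : ℕ, s ^ k ≤ C * ‖M ^ k‖ := by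
    intro k
    have h1 : s ^ k * w j ≤ ∑ i, w i * (A ^ k) i j := pow_smul_le_vecMul_pow hA hs h k j
    have h2 : ∑ i, w i * (A ^ k) i j ≤ (∑ i, w i) * ‖M ^ k‖ := by
      rw [Finset.sum_mul]
      refine Finset.sum_le_sum fun i _ => mul_le_mul_of_nonneg_left ?_ (hw i).le
      refine le_trans ?_ (norm_entry_le_linftyOp (M ^ k) i j)
      rw [hMk, Matrix.map_apply, Complex.norm_real]
      exact le_abs_self _
    rw [hC, div_mul_eq_mul_div, le_div_iff₀ (hw j)]
    exact h1.trans h2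
  have hlim := spectrum.pow_norm_pow_one_div_tendsto_nhds_spectralRadius M
  have hfin : spectralRadius ℂ M ≠ ⊤ := by
    obtain ⟨z, -, hz⟩ := spectrum.exists_nnnorm_eq_spectralRadius M
    rw [← hz]; exact ENNReal.coe_ne_top
  have hlim2 : Tendsto (fun k : ℕ => ‖M ^ k‖ ^ (1 / k : ℝ)) atTop (𝓝 (leadingEigenvalue A)) := by
    have := (ENNReal.tendsto_toReal hfin).comp hlim
    refine this.congr fun k => ?_
    simp only [Function.comp]
    exact ENNReal.toReal_ofReal (Real.rpow_nonneg (norm_nonneg _) _)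
  have hlim3 : Tendsto (fun k : ℕ => C ^ (1 / k : ℝ)) atTop (𝓝 1) := by
    have h0 : Tendsto (fun k : ℕ => (1 / k : ℝ)) atTop (𝓝 0) := tendsto_one_div_atTop_nhds_zero_nat
    simpa using (tendsto_const_nhds (x := C)).rpow h0 (.inl hC0.ne')
  have hlim4 := hlim3.mul hlim2
  rw [one_mul] at hlim4
  refine ge_of_tendsto hlim4 ?_
  filter_upwards [eventually_ge_atTop 1] with k hk1
  have hk0 : (k : ℝ) ≠ 0 := by positivity
  rw [← Real.mul_rpow hC0.le (norm_nonneg _)]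
  calc s = (s ^ k) ^ (1 / k : ℝ) := by
        rw [← Real.rpow_natCast, ← Real.rpow_mul hs, mul_one_div_cancel hk0, Real.rpow_one]
    _ ≤ _ := Real.rpow_le_rpow (pow_nonneg hs k) (hk k) (by positivity)

/-- The moduli of a complex left eigenvector for an eigenvalue of largest modulus. -/
lemma exists_nonneg_smul_le_vecMul [Nonempty D] {A : Matrix D D ℝ}
    (hA : ∀ i j, 0 ≤ A i j) :
    ∃ w : D → ℝ, 0 ≤ w ∧ w ≠ 0 ∧ leadingEigenvalue A • w ≤ w ᵥ* A := by
  set M : Matrix D D ℂ := A.map Complex.ofReal with hM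
  obtain ⟨z, hz, hzr⟩ := spectrum.exists_nnnorm_eq_spectralRadius M
  have hr : leadingEigenvalue A = ‖z‖ := by
    rw [leadingEigenvalue, ← hM, ← hzr]; rfl
  rw [spectrum.mem_iff, Matrix.isUnit_iff_isUnit_det, isUnit_iff_ne_zero, not_not,
    ← Matrix.exists_vecMul_eq_zero_iff] at hz
  obtain ⟨v, hv0, hv⟩ := hz
  refine ⟨fun i => ‖v i‖, fun i => norm_nonneg _, ?_, ?_⟩
  · obtain ⟨i, hi⟩ := Function.ne_iff.1 hv0
    exact Function.ne_iff.2 ⟨i, by simpa using hi⟩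
  · have hv' : v ᵥ* M = z • v := by
      rw [Matrix.vecMul_sub, sub_eq_zero, Algebra.algebraMap_eq_smul_one, Matrix.vecMul_smul,
        Matrix.vecMul_one] at hv
      exact hv.symm
    intro j
    have hj : ∑ i, v i * M i j = z * v j := congrFun hv' j
    calc leadingEigenvalue A * ‖v j‖ = ‖∑ i, v i * M i j‖ := by rw [hj, norm_mul, hr]
      _ ≤ ∑ i, ‖v i * M i j‖ := norm_sum_le _ _
      _ = ∑ i, ‖v i‖ * A i j := by
        refine Finset.sum_congr rfl fun i _ => ?_
        rw [norm_mul, hM, Matrix.map_apply, Complex.norm_real, Real.norm_of_nonneg (hA i j)]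

lemma Matrix.IsIrreducible.exists_sum_pow_pos {A : Matrix D D ℝ} (hA : A.IsIrreducible) :
    ∃ m : ℕ, ∀ i j, 0 < (∑ k ∈ Finset.range m, A ^ k) i j := by
  choose k _ hk using (Matrix.isIrreducible_iff_exists_pow_pos hA.nonneg).1 hA
  refine ⟨(Finset.univ.sup fun i => Finset.univ.sup fun j => k i j) + 1, fun i j => ?_⟩
  rw [Matrix.sum_apply]
  refine Finset.sum_pos' (fun l _ => Matrix.pow_apply_nonneg hA.nonneg l i j)
    ⟨k i j, Finset.mem_range_succ_iff.2 ?_, hk i j⟩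
  exact (Finset.le_sup (f := fun j => k i j) (Finset.mem_univ j)).trans
    (Finset.le_sup (f := fun i => Finset.univ.sup fun j => k i j) (Finset.mem_univ i))

/-- Perron–Frobenius: the spectral radius of an irreducible matrix has a strictly positive
left eigenvector, here normalized to a probability vector. For the killed kernel this is the
quasi-stationary distribution. -/
theorem Matrix.IsIrreducible.exists_leftEigenvector [Nonempty D] {A : Matrix D D ℝ}
    (hA : A.IsIrreducible) :
    ∃ μ : D → ℝ, (∀ i, 0 < μ i) ∧ ∑ i, μ i = 1 ∧ μ ᵥ* A = leadingEigenvalue A • μ := by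
  set r := leadingEigenvalue A with hr
  have hr0 : 0 ≤ r := ENNReal.toReal_nonneg
  obtain ⟨w, hw0, hwne, hw⟩ := exists_nonneg_smul_le_vecMul hA.nonneg
  obtain ⟨m, hm⟩ := hA.exists_sum_pow_pos
  set B := ∑ k ∈ Finset.range m, A ^ k with hB
  have hAB : B * A = A * B :=
    (Commute.sum_left _ _ _ fun k _ => (Commute.refl A).pow_left k).eq
  have hpos : ∀ d : D → ℝ, 0 ≤ d → d ≠ 0 → ∀ j, 0 < (d ᵥ* B) j := by
    intro d hd hdne j
    obtain ⟨i, hi⟩ := Function.ne_iff.1 hdne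
    exact Finset.sum_pos' (fun i _ => mul_nonneg (hd i) (hm i j).le)
      ⟨i, Finset.mem_univ i, mul_pos (lt_of_le_of_ne (hd i) (Ne.symm hi)) (hm i j)⟩
  have hu := hpos w hw0 hwne
  set u := w ᵥ* B with hu_def
  have hdB : (w ᵥ* A - r • w) ᵥ* B = u ᵥ* A - r • u := by
    rw [Matrix.sub_vecMul, vecMul_vecMul, smul_vecMul, hu_def, vecMul_vecMul, hAB]
  have hd : w ᵥ* A - r • w = 0 := by
    by_contra hne
    have hlt := hpos _ (sub_nonneg.2 hw) hne
    rw [hdB] at hlt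
    -- the strict inequality `r • u < u ᵥ* A` leaves room for a rate larger than `r`
    have hev : ∀ᶠ s in 𝓝[>] r, ∀ j, s * u j < (u ᵥ* A) j := by
      rw [eventually_all]
      intro j
      have hc : Tendsto (fun s : ℝ => s * u j) (𝓝[>] r) (𝓝 (r * u j)) :=
        ((continuous_id.mul continuous_const).tendsto r).mono_left nhdsWithin_le_nhds
      exact hc.eventually_lt_const (by simpa using hlt j)
    obtain ⟨s, hs, hsr⟩ := (hev.and self_mem_nhdsWithin).exists
    have := le_leadingEigenvalue_of_smul_le_vecMul hA.nonneg hu (hr0.trans (le_of_lt hsr))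
      (fun j => (hs j).le)
    exact absurd this (not_le.2 hsr)
  have hue : u ᵥ* A = r • u := by
    rw [hd, Matrix.zero_vecMul] at hdB
    exact (sub_eq_zero.1 hdB.symm)
  have hsum : 0 < ∑ i, u i := Finset.sum_pos (fun i _ => hu i) Finset.univ_nonempty
  refine ⟨(∑ i, u i)⁻¹ • u, fun i => mul_pos (inv_pos.2 hsum) (hu i), ?_, ?_⟩
  · simp only [Pi.smul_apply, smul_eq_mul, ← Finset.mul_sum]
    exact inv_mul_cancel₀ hsum.ne'
  · rw [smul_vecMul, hue, smul_comm]

end Perron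

/-! ### Survival probabilities of a killed kernel -/

section Survival

open Matrix

variable {D : Type*} [Fintype D] [DecidableEq D]

/-- The data of a killed chain that mixes fast: `Q` is the substochastic kernel of the killed
chain, `R` bounds its `T`-step kernel from above, every row of `R` is within a factor `1 ± δ` of
the subprobability vector `p`. In the application `R` and `p` are the restrictions of the
`T`-step transition matrix and of the stationary distribution to the surviving states. -/
structure IsFastMixingKilled (Q R : Matrix D D ℝ) (p : D → ℝ) (T : ℕ) (δ : ℝ) : Prop where
  nonneg : ∀ i j, 0 ≤ Q i j
  row_le_one : Q *ᵥ 1 ≤ 1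
  pow_le : ∀ i j, (Q ^ T) i j ≤ R i j
  sum_le_one : ∀ i, ∑ j, R i j ≤ 1
  lower : ∀ i j, (1 - δ) * p j ≤ R i j
  upper : ∀ i j, R i j ≤ (1 + δ) * p j
  weight_pos : ∀ j, 0 < p j
  weight_sum_le_one : ∑ j, p j ≤ 1

/-- A left eigenvector of `Q` that is a positive probability vector: a quasi-stationary
distribution with survival rate `r`. -/
structure IsQuasiStationary (Q : Matrix D D ℝ) (μ : D → ℝ) (r : ℝ) : Prop where
  pos : ∀ i, 0 < μ i
  sum_eq_one : ∑ i, μ i = 1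
  vecMul_eq : μ ᵥ* Q = r • μ

lemma IsQuasiStationary.vecMul_pow {Q : Matrix D D ℝ} {μ : D → ℝ} {r : ℝ}
    (h : IsQuasiStationary Q μ r) (t : ℕ) : μ ᵥ* Q ^ t = r ^ t • μ := by
  induction t with
  | zero => simp
  | succ t ih => rw [pow_succ, ← vecMul_vecMul, ih, smul_vecMul, h.vecMul_eq, smul_smul, pow_succ]

/-- Started from a quasi-stationary distribution, the survival time is exactly geometric. -/
lemma IsQuasiStationary.dotProduct_pow_one {Q : Matrix D D ℝ} {μ : D → ℝ} {r : ℝ}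
    (h : IsQuasiStationary Q μ r) (t : ℕ) : μ ⬝ᵥ (Q ^ t *ᵥ 1) = r ^ t := by
  rw [dotProduct_mulVec, h.vecMul_pow, smul_dotProduct, dotProduct_one, h.sum_eq_one, smul_eq_mul,
    mul_one]

variable {Q R : Matrix D D ℝ} {p μ : D → ℝ} {T : ℕ} {δ r : ℝ}

namespace IsFastMixingKilled

lemma mulVec_pow_nonneg (h : IsFastMixingKilled Q R p T δ) (t : ℕ) (i : D) :
    0 ≤ (Q ^ t *ᵥ 1) i :=
  Finset.sum_nonneg fun j _ =>
    mul_nonneg (Matrix.pow_apply_nonneg h.nonneg t i j) zero_le_one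

lemma mulVec_pow_le_one (h : IsFastMixingKilled Q R p T δ) (t : ℕ) (i : D) :
    (Q ^ t *ᵥ 1) i ≤ 1 := by
  induction t generalizing i with
  | zero => simp
  | succ t ih =>
    rw [pow_succ', ← mulVec_mulVec]
    calc (Q *ᵥ (Q ^ t *ᵥ 1)) i ≤ (Q *ᵥ 1) i :=
          Finset.sum_le_sum fun j _ => mul_le_mul_of_nonneg_left (ih j) (h.nonneg i j)
      _ ≤ 1 := h.row_le_one i

lemma dotProduct_nonneg (h : IsFastMixingKilled Q R p T δ) (t : ℕ) : 0 ≤ p ⬝ᵥ (Q ^ t *ᵥ 1) :=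
  Finset.sum_nonneg fun i _ => mul_nonneg (h.weight_pos i).le (h.mulVec_pow_nonneg t i)

lemma dotProduct_le_one (h : IsFastMixingKilled Q R p T δ) (t : ℕ) : p ⬝ᵥ (Q ^ t *ᵥ 1) ≤ 1 :=
  (Finset.sum_le_sum fun i _ =>
    mul_le_of_le_one_right (h.weight_pos i).le (h.mulVec_pow_le_one t i)).trans h.weight_sum_le_one

lemma rate_le_one (h : IsFastMixingKilled Q R p T δ) (hμ : IsQuasiStationary Q μ r) : r ≤ 1 := by
  have h1 := hμ.dotProduct_pow_one 1
  rw [pow_one r] at h1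
  rw [← h1, ← hμ.sum_eq_one]
  exact Finset.sum_le_sum fun i _ =>
    mul_le_of_le_one_right (hμ.pos i).le (h.mulVec_pow_le_one 1 i)

/-- Since `r ^ T • μ = μ Q ^ T ≤ μ R ≤ (1 + δ) p`, survival from `p` is at least about as likely as
survival from the quasi-stationary distribution. -/
lemma rate_pow_add_le (h : IsFastMixingKilled Q R p T δ) (hμ : IsQuasiStationary Q μ r) (t : ℕ) :
    r ^ (t + T) ≤ (1 + δ) * (p ⬝ᵥ (Q ^ t *ᵥ 1)) := by
  have h1 : ∀ j, r ^ T * μ j ≤ (1 + δ) * p j := by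
    intro j
    have h2 : ∑ i, μ i * (Q ^ T) i j = r ^ T * μ j := congrFun (hμ.vecMul_pow T) j
    rw [← h2]
    calc ∑ i, μ i * (Q ^ T) i j ≤ ∑ i, μ i * ((1 + δ) * p j) :=
          Finset.sum_le_sum fun i _ =>
            mul_le_mul_of_nonneg_left ((h.pow_le i j).trans (h.upper i j)) (hμ.pos i).le
      _ = (1 + δ) * p j := by rw [← Finset.sum_mul, hμ.sum_eq_one, one_mul]
  calc r ^ (t + T) = r ^ T * (μ ⬝ᵥ (Q ^ t *ᵥ 1)) := by
        rw [hμ.dotProduct_pow_one, pow_add, mul_comm]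
    _ = ∑ j, r ^ T * μ j * (Q ^ t *ᵥ 1) j := by
        rw [dotProduct, Finset.mul_sum]; simp only [mul_assoc]
    _ ≤ ∑ j, (1 + δ) * p j * (Q ^ t *ᵥ 1) j :=
        Finset.sum_le_sum fun j _ => mul_le_mul_of_nonneg_right (h1 j) (h.mulVec_pow_nonneg t j)
    _ = _ := by rw [dotProduct, Finset.mul_sum]; simp only [mul_assoc]

/-- The lower bound `r ^ T • μ ≥ (1 - δ) p - ρ`, where `ρ = μ (R - Q ^ T)` has mass at most
`1 - r ^ T`, turned into a recursive upper bound on the survival probabilities from `p`. -/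
lemma recursive_bound (h : IsFastMixingKilled Q R p T δ) (hμ : IsQuasiStationary Q μ r)
    (t : ℕ) :
    (1 - δ) * (p ⬝ᵥ (Q ^ (t + T) *ᵥ 1)) ≤
      r ^ (t + T) * r ^ T + (1 - r ^ T) * ((1 + δ) * (p ⬝ᵥ (Q ^ t *ᵥ 1))) := by
  set u := Q ^ (t + T) *ᵥ (1 : D → ℝ) with hu
  set a := (1 + δ) * (p ⬝ᵥ (Q ^ t *ᵥ 1)) with ha
  have hu0 : ∀ j, 0 ≤ u j := h.mulVec_pow_nonneg _
  have hua : ∀ j, u j ≤ a := by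
    intro j
    rw [hu, add_comm, pow_add, ← mulVec_mulVec, ha, dotProduct, Finset.mul_sum]
    refine Finset.sum_le_sum fun i _ => ?_
    rw [← mul_assoc]
    exact mul_le_mul_of_nonneg_right ((h.pow_le j i).trans (h.upper j i)) (h.mulVec_pow_nonneg t i)
  have hrμ : ∀ j, r ^ T * μ j = (μ ᵥ* R) j - (μ ᵥ* (R - Q ^ T)) j := by
    intro j
    rw [Matrix.vecMul_sub, hμ.vecMul_pow, Pi.sub_apply, Pi.smul_apply, smul_eq_mul]; ring
  have hR : ∀ j, (1 - δ) * p j ≤ (μ ᵥ* R) j := by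
    intro j
    calc (1 - δ) * p j = ∑ i, μ i * ((1 - δ) * p j) := by
          rw [← Finset.sum_mul, hμ.sum_eq_one, one_mul]
      _ ≤ _ := Finset.sum_le_sum fun i _ => mul_le_mul_of_nonneg_left (h.lower i j) (hμ.pos i).le
  have hρ0 : ∀ j, 0 ≤ (μ ᵥ* (R - Q ^ T)) j := fun j =>
    Finset.sum_nonneg fun i _ => mul_nonneg (hμ.pos i).le (sub_nonneg.2 (h.pow_le i j))
  have hρ : ∑ j, (μ ᵥ* (R - Q ^ T)) j ≤ 1 - r ^ T := by
    have h1 : ∑ j, (μ ᵥ* R) j ≤ 1 := by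
      rw [← dotProduct_one, ← dotProduct_mulVec, ← hμ.sum_eq_one]
      refine Finset.sum_le_sum fun i _ => mul_le_of_le_one_right (hμ.pos i).le ?_
      simpa [mulVec, dotProduct] using h.sum_le_one i
    have h2 : ∑ j, r ^ T * μ j = r ^ T := by rw [← Finset.mul_sum, hμ.sum_eq_one, mul_one]
    simp only [hrμ, Finset.sum_sub_distrib] at h2
    linarith
  have hmain : ∑ j, r ^ T * μ j * u j = r ^ (t + T) * r ^ T := by
    have := hμ.dotProduct_pow_one (t + T)
    rw [← hu, dotProduct] at this
    simp only [mul_assoc, ← Finset.mul_sum, this]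
    ring
  have h3 : ∑ j, (μ ᵥ* (R - Q ^ T)) j * u j ≤ (1 - r ^ T) * a := by
    calc _ ≤ ∑ j, (μ ᵥ* (R - Q ^ T)) j * a :=
          Finset.sum_le_sum fun j _ => mul_le_mul_of_nonneg_left (hua j) (hρ0 j)
      _ = (∑ j, (μ ᵥ* (R - Q ^ T)) j) * a := by rw [Finset.sum_mul]
      _ ≤ (1 - r ^ T) * a := by
          rcases isEmpty_or_nonempty D with hD | ⟨⟨j⟩⟩
          · have := hμ.sum_eq_one
            simp at this
          · exact mul_le_mul_of_nonneg_right hρ ((hu0 j).trans (hua j))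
  have h4 : (1 - δ) * (p ⬝ᵥ u) ≤ ∑ j, (μ ᵥ* R) j * u j := by
    rw [dotProduct, Finset.mul_sum]
    refine Finset.sum_le_sum fun j _ => ?_
    rw [← mul_assoc]
    exact mul_le_mul_of_nonneg_right (hR j) (hu0 j)
  simp only [hrμ, sub_mul, Finset.sum_sub_distrib] at hmain
  linarith

/-- If the chain started from `p` is unlikely to be killed within time `T`, then the survival rate
per `T` steps is close to `1`. Most of the mass of `p` sits on the set `G` of states from which
survival is likely, and by mixing a surviving chain started in `G` is likely to be in `G` again
after `T` steps; hence `Q ^ T 1_G ≥ (1 - 3 s) 1_G`, and this is tested against the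
quasi-stationary distribution. -/
lemma rate_pow_ge (h : IsFastMixingKilled Q R p T δ) (hμ : IsQuasiStationary Q μ r) {s : ℝ}
    (hs : 0 < s) (hs2 : s ≤ 1 / 4) (hδ0 : 0 ≤ δ) (hδ : δ ≤ 1)
    (hkill : 1 - s ^ 2 ≤ p ⬝ᵥ (Q ^ T *ᵥ 1)) : 1 - 3 * s ≤ r ^ T := by
  set v := Q ^ T *ᵥ (1 : D → ℝ) with hv
  set G := Finset.univ.filter fun i => 1 - s ≤ v i with hG
  have hbad : ∑ i with ¬ (1 - s ≤ v i), p i ≤ s := by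
    have h1 : ∑ i with ¬ (1 - s ≤ v i), p i * s ≤ ∑ i, p i * (1 - v i) := by
      rw [Finset.sum_filter]
      refine Finset.sum_le_sum fun i _ => ?_
      split_ifs with hi
      · exact mul_nonneg (h.weight_pos i).le (sub_nonneg.2 (h.mulVec_pow_le_one T i))
      · exact mul_le_mul_of_nonneg_left (by linarith) (h.weight_pos i).le
    have h2 : ∑ i, p i * (1 - v i) = ∑ i, p i - p ⬝ᵥ v := by
      simp only [mul_sub, mul_one, Finset.sum_sub_distrib, dotProduct]
    rw [← Finset.sum_mul] at h1
    have h3 := h.weight_sum_le_one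
    refine le_of_mul_le_mul_right (?_ : _ ≤ s * s) hs
    nlinarith
  have hstep : ∀ i ∈ G, 1 - 3 * s ≤ ∑ j ∈ G, (Q ^ T) i j := by
    intro i hi
    have hi' : 1 - s ≤ v i := (Finset.mem_filter.1 hi).2
    have hvi : v i = ∑ j ∈ G, (Q ^ T) i j + ∑ j with ¬ (1 - s ≤ v j), (Q ^ T) i j := by
      rw [hG, Finset.sum_filter_add_sum_filter_not]
      simp [hv, mulVec, dotProduct]
    have h2 : ∑ j with ¬ (1 - s ≤ v j), (Q ^ T) i j ≤ (1 + δ) * s := by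
      calc _ ≤ ∑ j with ¬ (1 - s ≤ v j), (1 + δ) * p j :=
            Finset.sum_le_sum fun j _ => (h.pow_le i j).trans (h.upper i j)
        _ = (1 + δ) * ∑ j with ¬ (1 - s ≤ v j), p j := by rw [Finset.mul_sum]
        _ ≤ _ := mul_le_mul_of_nonneg_left hbad (by linarith)
    nlinarith
  have hGne : G.Nonempty := by
    by_contra hne
    rw [Finset.not_nonempty_iff_eq_empty, hG, Finset.filter_eq_empty_iff] at hne
    have h1 : ∑ i with ¬ (1 - s ≤ v i), p i = ∑ i, p i := by
      rw [Finset.filter_true_of_mem fun i hi => hne hi]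
    have h2 : p ⬝ᵥ v ≤ ∑ i, p i := Finset.sum_le_sum fun i _ =>
      mul_le_of_le_one_right (h.weight_pos i).le (h.mulVec_pow_le_one T i)
    nlinarith
  have hμG : 0 < ∑ i ∈ G, μ i := Finset.sum_pos (fun i _ => hμ.pos i) hGne
  have hrG : r ^ T * ∑ j ∈ G, μ j = ∑ i, μ i * ∑ j ∈ G, (Q ^ T) i j := by
    simp only [Finset.mul_sum]
    rw [Finset.sum_comm]
    refine Finset.sum_congr rfl fun j _ => ?_
    exact (congrFun (hμ.vecMul_pow T) j).symm
  refine le_of_mul_le_mul_right ?_ hμG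
  rw [hrG, Finset.mul_sum]
  calc ∑ i ∈ G, (1 - 3 * s) * μ i ≤ ∑ i ∈ G, μ i * ∑ j ∈ G, (Q ^ T) i j :=
        Finset.sum_le_sum fun i hi => by
          rw [mul_comm]; exact mul_le_mul_of_nonneg_left (hstep i hi) (hμ.pos i).le
    _ ≤ _ := Finset.sum_le_sum_of_subset_of_nonneg (Finset.subset_univ _) fun i _ _ =>
        mul_nonneg (hμ.pos i).le (Finset.sum_nonneg fun j _ =>
          Matrix.pow_apply_nonneg h.nonneg T i j)

/-- Survival from `p` decays like `r ^ t`, uniformly in `t`. The constant `20` is what makes the upper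
bound propagate through `recursive_bound`; it is not optimized. -/
theorem abs_div_pow_sub_one_le (h : IsFastMixingKilled Q R p T δ) (hμ : IsQuasiStationary Q μ r)
    (hr : 0 ≤ r) (hT : 0 < T) {s : ℝ} (hs : 0 < s) (hs2 : s ≤ 1 / 20) (hδ0 : 0 ≤ δ) (hδ : δ ≤ s)
    (hkill : 1 - s ^ 2 ≤ p ⬝ᵥ (Q ^ T *ᵥ 1)) (t : ℕ) :
    |p ⬝ᵥ (Q ^ t *ᵥ 1) / r ^ t - 1| ≤ 20 * s := by
  have hgap := h.rate_pow_ge hμ hs (by linarith) hδ0 (by linarith) hkill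
  have hr1 := h.rate_le_one hμ
  have hrpos : 0 < r := by
    rcases hr.lt_or_eq with h0 | h0
    · exact h0
    · rw [← h0, zero_pow hT.ne'] at hgap
      linarith
  have hlow : ∀ t, (1 - 4 * s) * r ^ t ≤ p ⬝ᵥ (Q ^ t *ᵥ 1) := by
    intro t
    have h1 := h.rate_pow_add_le hμ t
    have h2 := pow_pos hrpos t
    have h3 := h.dotProduct_nonneg t
    rw [pow_add] at h1
    have h4 : (1 - 3 * s) * r ^ t ≤ (1 + s) * (p ⬝ᵥ (Q ^ t *ᵥ 1)) := by nlinarith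
    have h5 : (1 - 4 * s) * (1 + s) ≤ 1 - 3 * s := by nlinarith
    refine le_of_mul_le_mul_left (?_ : (1 + s) * _ ≤ (1 + s) * _) (by linarith)
    nlinarith
  have hup : ∀ t, p ⬝ᵥ (Q ^ t *ᵥ 1) ≤ (1 + 20 * s) * r ^ t := by
    intro t
    induction t using Nat.strong_induction_on with
    | _ t ih =>
      rcases lt_or_ge t T with ht | ht
      -- for `t < T` the trivial bound suffices, as `1 - 3 * s ≤ r ^ T ≤ r ^ t`
      · have h1 : r ^ T ≤ r ^ t := pow_le_pow_of_le_one hr hr1 ht.le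
        have h2 := h.dotProduct_le_one t
        have h3 : 1 ≤ (1 + 20 * s) * (1 - 3 * s) := by nlinarith
        nlinarith
      · obtain ⟨q, rfl⟩ := Nat.exists_eq_add_of_le' ht
        have hq := ih q (by omega)
        have hrec := h.recursive_bound hμ q
        have hq0 := pow_pos hrpos q
        have hqT := pow_pos hrpos (q + T)
        have hT0 := pow_pos hrpos T
        have hT1 : r ^ T ≤ 1 := pow_le_one₀ hr hr1
        have h0 := h.dotProduct_nonneg q
        have h0' := h.dotProduct_nonneg (q + T)
        -- the previous survival probability, measured in units of `r ^ (q + T)`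
        have h5 : p ⬝ᵥ (Q ^ q *ᵥ 1) ≤ 2.5 * r ^ (q + T) := by
          rw [pow_add]
          nlinarith
        have h6 : (1 - r ^ T) * ((1 + δ) * (p ⬝ᵥ (Q ^ q *ᵥ 1))) ≤
            3 * s * ((1 + s) * (2.5 * r ^ (q + T))) := by
          gcongr
          linarith
        have h7 : (1 - s) * (p ⬝ᵥ (Q ^ (q + T) *ᵥ 1)) ≤
            (1 + 3 * s * ((1 + s) * 2.5)) * r ^ (q + T) := by
          nlinarith
        have h8 : 1 + 3 * s * ((1 + s) * 2.5) ≤ (1 - s) * (1 + 20 * s) := by nlinarith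
        refine le_of_mul_le_mul_left (?_ : (1 - s) * _ ≤ (1 - s) * _) (by linarith)
        nlinarith
  have hrt := pow_pos hrpos t
  rw [abs_le]
  constructor
  · have := (le_div_iff₀ hrt).2 (hlow t)
    linarith
  · have := (div_le_iff₀ hrt).2 (hup t)
    linarith

end IsFastMixingKilled

end Survival

/-! ### The law of the hitting time -/

section HittingTime

open Matrix

variable {Ω S : Type*} [MeasurableSpace Ω] [Fintype S] [DecidableEq S]
  {Pr : Measure Ω} {X : ℕ → Ω → S} {π : S → ℝ} {P : Matrix S S ℝ}

omit [Fintype S] [DecidableEq S] in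
lemma measureReal_eq_sum_inter_fiber {ι : Type*} [Fintype ι] [IsFiniteMeasure Pr] {f : Ω → ι}
    (hf : ∀ i, MeasurableSet {ω | f ω = i}) (E : Set Ω) :
    Pr.real E = ∑ i, Pr.real (E ∩ {ω | f ω = i}) := by
  have h := sum_measureReal_preimage_singleton (μ := Pr.restrict E) Finset.univ (f := f)
    fun i _ => hf i
  rw [Finset.coe_univ, Set.preimage_univ, measureReal_restrict_apply_univ] at h
  rw [← h]
  refine Finset.sum_congr rfl fun i _ => ?_
  rw [measureReal_restrict_apply (show MeasurableSet (f ⁻¹' {i}) from hf i), Set.inter_comm]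
  rfl

lemma lt_hitTime_iff {Ω S : Type*} (X : ℕ → Ω → S) (x : S) (t : ℕ) (ω : Ω) :
    (t : WithTop ℕ) < hitTime X x ω ↔ ∀ s ≤ t, X s ω ≠ x := by
  rw [← not_le]
  change ¬ hittingAfter X {x} 0 ω ≤ WithTop.some t ↔ _
  rw [hittingAfter_le_iff]
  simp

omit [DecidableEq S] in
lemma IsMarkovChain.measurableSet_forall_mem (h : IsMarkovChain Pr X π P) (t : ℕ)
    (A : ℕ → Set S) : MeasurableSet {ω | ∀ s ≤ t, X s ω ∈ A s} := by
  simp only [Set.ofPred_forall]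
  refine MeasurableSet.iInter fun s => MeasurableSet.iInter fun _ => ?_
  have : {ω | X s ω ∈ A s} = ⋃ y ∈ A s, {ω | X s ω = y} := by ext; simp
  rw [this]
  exact MeasurableSet.biUnion (Set.to_countable _) fun y _ => h.measurableSet_eq s y

/-- Cylinder sets satisfy the Markov property: the law of the first `t` steps being in a product
set extends by one step through the row of the current state. -/
lemma IsMarkovChain.measureReal_step (h : IsMarkovChain Pr X π P) (t : ℕ) (A : ℕ → Set S)
    (y z : S) :
    Pr.real {ω | (∀ s ≤ t, X s ω ∈ A s) ∧ X t ω = y ∧ X (t + 1) ω = z} =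
      Pr.real {ω | (∀ s ≤ t, X s ω ∈ A s) ∧ X t ω = y} * P y z := by
  classical
  have := h.isProbabilityMeasure
  -- decompose over the trajectory up to time `t`
  let path : Ω → (Finset.range (t + 1) → S) := fun ω s => X s ω
  let ext : (Finset.range (t + 1) → S) → ℕ → S := fun q s =>
    if hs : s ∈ Finset.range (t + 1) then q ⟨s, hs⟩ else z
  have hext : ∀ q ω, path ω = q ↔ ∀ s ≤ t, X s ω = ext q s := by
    intro q ω
    constructor
    · rintro rfl s hs
      have hs' : s ∈ Finset.range (t + 1) := Finset.mem_range.2 (by omega)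
      simp only [ext, path, dif_pos hs']
    · intro hq
      funext ⟨s, hs⟩
      have := hq s (Nat.lt_succ_iff.1 (Finset.mem_range.1 hs))
      simpa only [ext, dif_pos hs] using this
  have hextlast : ∀ q, ext q (t + 1) = z := fun q => by simp [ext]
  have hmeas : ∀ q, MeasurableSet {ω | path ω = q} := by
    intro q
    simp only [hext]
    exact h.measurableSet_forall_mem t fun s => {ext q s}
  have hdecomp := fun E => measureReal_eq_sum_inter_fiber (Pr := Pr) hmeas E
  rw [hdecomp, hdecomp {ω | (∀ s ≤ t, X s ω ∈ A s) ∧ X t ω = y}, Finset.sum_mul]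
  refine Finset.sum_congr rfl fun q _ => ?_
  by_cases hq : (∀ s ≤ t, ext q s ∈ A s) ∧ ext q t = y
  · have h1 : {ω | (∀ s ≤ t, X s ω ∈ A s) ∧ X t ω = y ∧ X (t + 1) ω = z} ∩ {ω | path ω = q} =
        {ω | ∀ s ≤ t + 1, X s ω = ext q s} := by
      ext ω
      simp only [Set.mem_inter_iff, Set.mem_ofPred_eq, hext]
      constructor
      · rintro ⟨⟨-, -, hz⟩, hω⟩ s hs
        rcases Nat.le_succ_iff.1 hs with hs | rfl
        · exact hω s hs
        · rw [hz, hextlast]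
      · intro hω
        have hω' : ∀ s ≤ t, X s ω = ext q s := fun s hs => hω s (by omega)
        refine ⟨⟨fun s hs => ?_, ?_, ?_⟩, hω'⟩
        · rw [hω' s hs]; exact hq.1 s hs
        · rw [hω' t le_rfl]; exact hq.2
        · rw [hω _ le_rfl, hextlast]
    have h2 : {ω | (∀ s ≤ t, X s ω ∈ A s) ∧ X t ω = y} ∩ {ω | path ω = q} =
        {ω | ∀ s ≤ t, X s ω = ext q s} := by
      ext ω
      simp only [Set.mem_inter_iff, Set.mem_ofPred_eq, hext]
      constructor
      · rintro ⟨-, hω⟩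
        exact hω
      · intro hω
        refine ⟨⟨fun s hs => ?_, ?_⟩, hω⟩
        · rw [hω s hs]; exact hq.1 s hs
        · rw [hω t le_rfl]; exact hq.2
    rw [h1, h2, h.step t (ext q), hq.2, hextlast]
  · have h2 : {ω | (∀ s ≤ t, X s ω ∈ A s) ∧ X t ω = y} ∩ {ω | path ω = q} = ∅ := by
      rw [Set.eq_empty_iff_forall_notMem]
      rintro ω ⟨⟨hA, hy⟩, hω⟩
      have hω := (hext q ω).1 hω
      refine hq ⟨fun s hs => ?_, ?_⟩
      · rw [← hω s hs]; exact hA s hs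
      · rw [← hω t le_rfl]; exact hy
    have h1 : {ω | (∀ s ≤ t, X s ω ∈ A s) ∧ X t ω = y ∧ X (t + 1) ω = z} ∩ {ω | path ω = q} = ∅ :=
      by
      refine Set.subset_eq_empty ?_ h2
      rintro ω ⟨⟨hA, hy, -⟩, hω⟩
      exact ⟨⟨hA, hy⟩, hω⟩
    rw [h1, h2, measureReal_empty, zero_mul]

/-- The law of the chain at time `t` on the event that `x` has not been visited. -/
lemma IsMarkovChain.measureReal_avoid (h : IsMarkovChain Pr X π P) (x : S) (t : ℕ)
    (z : {y // y ≠ x}) :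
    Pr.real {ω | (∀ s ≤ t, X s ω ≠ x) ∧ X t ω = z} =
      ((fun y : {y // y ≠ x} => π y) ᵥ* killed P x ^ t) z := by
  have := h.isProbabilityMeasure
  induction t generalizing z with
  | zero =>
    rw [pow_zero, Matrix.vecMul_one, ← h.initial]
    congr 1
    ext ω
    simp only [Set.mem_ofPred_eq, Nat.le_zero_eq, forall_eq, and_iff_right_iff_imp]
    rintro hz
    rw [hz]
    exact z.2
  | succ t ih =>
    have hset : ∀ y, {ω | (∀ s ≤ t + 1, X s ω ≠ x) ∧ X (t + 1) ω = z} ∩ {ω | X t ω = y} =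
        {ω | (∀ s ≤ t, X s ω ∈ ({x}ᶜ : Set S)) ∧ X t ω = y ∧ X (t + 1) ω = z} := by
      intro y
      ext ω
      simp only [Set.mem_inter_iff, Set.mem_ofPred_eq, Set.mem_compl_iff, Set.mem_singleton_iff]
      constructor
      · rintro ⟨⟨h1, h2⟩, h3⟩
        exact ⟨fun s hs => h1 s (by omega), h3, h2⟩
      · rintro ⟨h1, h3, h2⟩
        refine ⟨⟨fun s hs => ?_, h2⟩, h3⟩
        rcases Nat.le_succ_iff.1 hs with hs | rfl
        · exact h1 s hs
        · rw [h2]; exact z.2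
    rw [measureReal_eq_sum_inter_fiber (h.measurableSet_eq t)]
    simp only [hset, h.measureReal_step]
    have hx : {ω | (∀ s ≤ t, X s ω ∈ ({x}ᶜ : Set S)) ∧ X t ω = x} = ∅ := by
      rw [Set.eq_empty_iff_forall_notMem]
      rintro ω ⟨h1, h2⟩
      exact h1 t le_rfl h2
    rw [Fintype.sum_eq_add_sum_subtype_ne _ x, hx, measureReal_empty, zero_mul, zero_add, pow_succ,
      ← vecMul_vecMul]
    exact Finset.sum_congr rfl fun y _ => congrArg (· * P y z) (ih y)

/-- Survival probabilities of the chain are those of the killed kernel. -/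
lemma IsMarkovChain.measureReal_lt_hitTime (h : IsMarkovChain Pr X π P) (x : S) (t : ℕ) :
    Pr.real {ω | (t : WithTop ℕ) < hitTime X x ω} =
      (fun y : {y // y ≠ x} => π y) ⬝ᵥ (killed P x ^ t *ᵥ 1) := by
  have := h.isProbabilityMeasure
  simp only [lt_hitTime_iff]
  rw [measureReal_eq_sum_inter_fiber (h.measurableSet_eq t), Fintype.sum_eq_add_sum_subtype_ne _ x,
    dotProduct_mulVec, dotProduct_one]
  have hx : {ω | ∀ s ≤ t, X s ω ≠ x} ∩ {ω | X t ω = x} = ∅ := by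
    rw [Set.eq_empty_iff_forall_notMem]
    rintro ω ⟨h1, h2⟩
    exact h1 t le_rfl h2
  rw [hx, measureReal_empty, zero_add]
  exact Finset.sum_congr rfl fun y _ => h.measureReal_avoid x t y

end HittingTime

/-! ### Comparison of the killed chain with the stationary chain -/

section Killed

open Matrix

variable {S : Type*} [Fintype S] [DecidableEq S] {P : Matrix S S ℝ} {π : S → ℝ}

omit [Fintype S] [DecidableEq S] in
lemma killed_nonneg (hP : ∀ i j, 0 ≤ P i j) (x : S) (i j : {y // y ≠ x}) : 0 ≤ killed P x i j :=
  hP i j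

lemma killed_pow_le (hP : ∀ i j, 0 ≤ P i j) (x : S) (t : ℕ) (i j : {y // y ≠ x}) :
    (killed P x ^ t) i j ≤ (P ^ t) i j := by
  induction t generalizing j with
  | zero => simp [Matrix.one_apply, Subtype.ext_iff]
  | succ t ih =>
    rw [pow_succ, pow_succ, Matrix.mul_apply, Matrix.mul_apply,
      Fintype.sum_eq_add_sum_subtype_ne _ x]
    refine le_add_of_nonneg_of_le (mul_nonneg (Matrix.pow_apply_nonneg hP t i x) (hP x j)) ?_
    exact Finset.sum_le_sum fun k _ => mul_le_mul_of_nonneg_right (ih k) (hP k j)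

lemma killed_mulVec_one (hP : P ∈ Matrix.rowStochastic ℝ S) (x : S) (i : {y // y ≠ x}) :
    (killed P x *ᵥ 1) i = 1 - P i x := by
  have h := Matrix.sum_row_of_mem_rowStochastic hP i
  rw [Fintype.sum_eq_add_sum_subtype_ne _ x] at h
  rw [eq_sub_iff_add_eq', ← h]
  simp [mulVec, dotProduct, killed]

/-- Restricting the stationary distribution to the complement of `x` gives a subinvariant vector
of the killed kernel. -/
lemma IsStationaryDistribution.vecMul_killed_pow_le (hπ : IsStationaryDistribution P π)
    (hP : ∀ i j, 0 ≤ P i j) (x : S) (t : ℕ) :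
    (fun y : {y // y ≠ x} => π y) ᵥ* killed P x ^ t ≤ fun y : {y // y ≠ x} => π y := by
  induction t with
  | zero => simp
  | succ t ih =>
    rw [pow_succ, ← vecMul_vecMul]
    refine (vecMul_mono_left (killed_nonneg hP x) ih).trans fun j => ?_
    have h : ∑ i, π i * P i j = π j := congrFun hπ.invariant j
    rw [Fintype.sum_eq_add_sum_subtype_ne _ x] at h
    have h0 := mul_nonneg (hπ.mem_stdSimplex.1 x) (hP x j)
    have : ((fun y : {y // y ≠ x} => π y) ᵥ* killed P x) j =
      ∑ i : {y // y ≠ x}, π i * P i j := rfl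
    dsimp only
    linarith

/-- The union bound `ℙ_π(τ_x ≤ t) ≤ (t + 1) π(x)`. -/
lemma IsStationaryDistribution.one_sub_le_dotProduct (hπ : IsStationaryDistribution P π)
    (hP : P ∈ Matrix.rowStochastic ℝ S) (x : S) (t : ℕ) :
    1 - (t + 1) * π x ≤ (fun y : {y // y ≠ x} => π y) ⬝ᵥ (killed P x ^ t *ᵥ 1) := by
  induction t with
  | zero =>
    have h := hπ.mem_stdSimplex.2
    rw [Fintype.sum_eq_add_sum_subtype_ne _ x] at h
    simp only [pow_zero, one_mulVec, dotProduct_one]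
    push_cast
    linarith
  | succ t ih =>
    set p : {y // y ≠ x} → ℝ := fun y => π y with hp
    have h1 : p ⬝ᵥ (killed P x ^ (t + 1) *ᵥ 1) =
        p ⬝ᵥ (killed P x ^ t *ᵥ 1) - ∑ i, (p ᵥ* killed P x ^ t) i * P i x := by
      rw [pow_succ, ← mulVec_mulVec, dotProduct_mulVec, dotProduct_mulVec p, dotProduct_one,
        dotProduct, ← Finset.sum_sub_distrib]
      exact Finset.sum_congr rfl fun i _ => by rw [killed_mulVec_one hP]; ring
    have h2 : ∑ i, (p ᵥ* killed P x ^ t) i * P i x ≤ ∑ i : {y // y ≠ x}, π i * P i x :=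
      Finset.sum_le_sum fun i _ =>
        mul_le_mul_of_nonneg_right (hπ.vecMul_killed_pow_le hP.1 x t i) (hP.1 i x)
    have h3 : ∑ i, π i * P i x = π x := congrFun hπ.invariant x
    rw [Fintype.sum_eq_add_sum_subtype_ne _ x] at h3
    have h4 := mul_nonneg (hπ.mem_stdSimplex.1 x) (hP.1 x x)
    push_cast
    linarith

lemma IsStationaryDistribution.isFastMixingKilled (hπ : IsStationaryDistribution P π)
    (hP : P ∈ Matrix.rowStochastic ℝ S) (hpos : ∀ y, 0 < π y) {T : ℕ} {δ : ℝ}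
    (hmix : ∀ x y, |(P ^ T) x y - π y| ≤ δ * π y) (x : S) :
    IsFastMixingKilled (killed P x) ((P ^ T).submatrix Subtype.val Subtype.val)
      (fun y => π y) T δ where
  nonneg := killed_nonneg hP.1 x
  row_le_one i := by
    rw [killed_mulVec_one hP]
    exact sub_le_self _ (hP.1 i x)
  pow_le := killed_pow_le hP.1 x T
  sum_le_one i := by
    have hPT := pow_mem hP T
    have h := Matrix.sum_row_of_mem_rowStochastic hPT i
    rw [Fintype.sum_eq_add_sum_subtype_ne _ x] at h
    have h0 : 0 ≤ (P ^ T) i x := hPT.1 i x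
    simp only [Matrix.submatrix_apply]
    linarith
  lower i j := by
    have := (abs_le.1 (hmix i j)).1
    simp only [Matrix.submatrix_apply]
    linarith
  upper i j := by
    have := (abs_le.1 (hmix i j)).2
    simp only [Matrix.submatrix_apply]
    linarith
  weight_pos j := hpos j
  weight_sum_le_one := by
    have h := hπ.mem_stdSimplex.2
    rw [Fintype.sum_eq_add_sum_subtype_ne _ x] at h
    linarith [hpos x]

end Killed

/-! ### The first visit time lemma -/

lemma one_le_expectedReturns {S : Type*} [Fintype S] [DecidableEq S] {P : Matrix S S ℝ}
    (hP : ∀ i j, 0 ≤ P i j) (T : ℕ) (x : S) : 1 ≤ expectedReturns P T x := by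
  have h := Finset.single_le_sum (f := fun t => (P ^ t) x x)
    (fun t _ => Matrix.pow_apply_nonneg hP t x x) (Finset.mem_range.2 T.succ_pos)
  simpa [expectedReturns] using h

open Matrix in
/-- The two approximations for a single chain. The second one holds because the eigenvalue and
the quantity `1 - π x / expectedReturns P T x` are both close to `1`. -/
theorem IsMarkovChain.first_visit_bounds {Ω S : Type*} [MeasurableSpace Ω] [Fintype S]
    [DecidableEq S] {Pr : Measure Ω} {X : ℕ → Ω → S} {π : S → ℝ} {P : Matrix S S ℝ}
    (h : IsMarkovChain Pr X π P) (hP : P ∈ Matrix.rowStochastic ℝ S)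
    (hπ : IsStationaryDistribution P π) (hpos : ∀ y, 0 < π y) {T : ℕ} (hT : 0 < T) {s : ℝ}
    (hs : 0 < s) (hs2 : s ≤ 1 / 20) (hmix : ∀ x y, |(P ^ T) x y - π y| ≤ s * π y)
    (x : S) [Nonempty {y // y ≠ x}] (hK : (killed P x).IsIrreducible)
    (hsmall : (T + 1) * π x ≤ s ^ 2) :
    (∀ t : ℕ, |Pr.real {ω | (t : WithTop ℕ) < hitTime X x ω} /
        leadingEigenvalue (killed P x) ^ t - 1| ≤ 20 * s) ∧
      |leadingEigenvalue (killed P x) / (1 - π x / expectedReturns P T x) - 1| ≤ 20 * s := by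
  obtain ⟨μ, hμ0, hμ1, hμ⟩ := hK.exists_leftEigenvector
  have hQS : IsQuasiStationary (killed P x) μ (leadingEigenvalue (killed P x)) := ⟨hμ0, hμ1, hμ⟩
  have hmixK := hπ.isFastMixingKilled hP hpos hmix x
  have hr0 : 0 ≤ leadingEigenvalue (killed P x) := ENNReal.toReal_nonneg
  have hkill : 1 - s ^ 2 ≤ (fun y : {y // y ≠ x} => π y) ⬝ᵥ (killed P x ^ T *ᵥ 1) :=
    (sub_le_sub_left hsmall 1).trans (hπ.one_sub_le_dotProduct hP x T)
  constructor
  · intro t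
    rw [h.measureReal_lt_hitTime]
    exact hmixK.abs_div_pow_sub_one_le hQS hr0 hT hs hs2 hs.le le_rfl hkill t
  · have hr1 := hmixK.rate_le_one hQS
    have hr2 : 1 - 3 * s ≤ leadingEigenvalue (killed P x) :=
      (hmixK.rate_pow_ge hQS hs (by linarith) hs.le (by linarith) hkill).trans
        (pow_le_of_le_one hr0 hr1 hT.ne')
    have hR := one_le_expectedReturns hP.1 T x
    have hq0 : 0 ≤ π x / expectedReturns P T x := div_nonneg (hpos x).le (by linarith)
    have hq1 : π x / expectedReturns P T x ≤ s := by
      have hT0 : (0 : ℝ) ≤ T := T.cast_nonneg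
      have h1 := div_le_self (hpos x).le hR
      nlinarith [hpos x]
    have hden : 0 < 1 - π x / expectedReturns P T x := by linarith
    have h1 : 1 - 20 * s ≤ leadingEigenvalue (killed P x) / (1 - π x / expectedReturns P T x) := by
      rw [le_div_iff₀ hden]
      nlinarith
    have h2 : leadingEigenvalue (killed P x) / (1 - π x / expectedReturns P T x) ≤ 1 + 20 * s := by
      rw [div_le_iff₀ hden]
      nlinarith
    rw [abs_le]
    constructor <;> linarith

theorem theorem1
    -- the state spaces, with `n` elements
    (S : ℕ → Type*) [∀ n, Fintype (S n)] [∀ n, DecidableEq (S n)]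
    (hcard : ∀ n, Fintype.card (S n) = n)
    -- transition matrices, stationary distributions
    (P : ∀ n, Matrix (S n) (S n) ℝ) (π : ∀ n, S n → ℝ)
    (hP : ∀ᶠ n in atTop, P n ∈ Matrix.rowStochastic ℝ (S n))
    (hErg : ∀ᶠ n in atTop, IsErgodic (P n))
    (hπ : ∀ᶠ n in atTop, IsStationaryDistribution (P n) (π n))
    (hKilled : ∀ᶠ n in atTop, ∀ x : S n, (killed (P n) x).IsIrreducible)
    -- the chains started at stationarity
    (Ω : ℕ → Type*) [∀ n, MeasurableSpace (Ω n)] (Pr : ∀ n, Measure (Ω n))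
    (X : ∀ n, ℕ → Ω n → S n)
    (hX : ∀ᶠ n in atTop, IsMarkovChain (Pr n) (X n) (π n) (P n))
    (c : ℝ) (hc : 2 < c) (T : ℕ → ℕ) (hT : Tendsto T atTop atTop)
    -- (HP1) fast mixing
    (hp1 : (fun n => ⨆ x : S n, ⨆ y : S n, |(P n ^ T n) x y - π n y|) =o[atTop]
      fun n : ℕ => (n : ℝ) ^ (-c))
    -- (HP2) small maximum of the stationary distribution
    (hp2 : Tendsto (fun n => (T n : ℝ) * ⨆ x : S n, π n x) atTop (𝓝 0))
    -- (HP3) large minimum of the stationary distribution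
    (hp3 : (fun n : ℕ => (n : ℝ) ^ (-2 : ℝ)) =o[atTop] fun n => ⨅ x : S n, π n x) :
    -- both convergences are uniform in the state
    Tendsto (fun n => ⨆ x : S n, ⨆ t : ℕ, ENNReal.ofReal
        |(Pr n).real {ω | (t : WithTop ℕ) < hitTime (X n) x ω} /
            leadingEigenvalue (killed (P n) x) ^ t - 1|) atTop (𝓝 0) ∧
      Tendsto (fun n => ⨆ x : S n, ENNReal.ofReal
        |leadingEigenvalue (killed (P n) x) /
            (1 - π n x / expectedReturns (P n) (T n) x) - 1|) atTop (𝓝 0) := by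
  have key : ∀ s : ℝ, 0 < s → s ≤ 1 / 20 → ∀ᶠ n in atTop, ∀ x : S n,
      (∀ t : ℕ, |(Pr n).real {ω | (t : WithTop ℕ) < hitTime (X n) x ω} /
        leadingEigenvalue (killed (P n) x) ^ t - 1| ≤ 20 * s) ∧
      |leadingEigenvalue (killed (P n) x) /
        (1 - π n x / expectedReturns (P n) (T n) x) - 1| ≤ 20 * s := by
    intro s hs hs2
    have hs3 : 0 < s ^ 2 / 2 := by positivity
    filter_upwards [hP, hπ, hKilled, hX, hT.eventually_ge_atTop 1, hp1.bound one_pos, hp3.bound hs,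
      hp2.eventually_le_const hs3, eventually_ge_atTop 2] with n hPn hπn hKn hXn hTn h1 h3 h2 hn
    have hn1 : (1 : ℝ) ≤ n := by exact_mod_cast (by omega : 1 ≤ n)
    have hn0 : (0 : ℝ) < n := by linarith
    have hinf0 : 0 ≤ ⨅ x, π n x := Real.iInf_nonneg fun x => hπn.mem_stdSimplex.1 x
    have hpow : (0 : ℝ) < (n : ℝ) ^ (-2 : ℝ) := Real.rpow_pos_of_pos hn0 _
    rw [Real.norm_of_nonneg hpow.le, Real.norm_of_nonneg hinf0] at h3
    have hinf : 0 < ⨅ x, π n x := pos_of_mul_pos_right (hpow.trans_le h3) hs.le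
    have hinf_le : ∀ y, ⨅ x, π n x ≤ π n y := fun y => ciInf_le (Set.finite_range _).bddBelow y
    have hpos : ∀ y, 0 < π n y := fun y => hinf.trans_le (hinf_le y)
    have hmix : ∀ x y, |(P n ^ T n) x y - π n y| ≤ s * π n y := by
      intro x y
      calc |(P n ^ T n) x y - π n y| ≤ ⨆ y, |(P n ^ T n) x y - π n y| := by
            exact le_ciSup (f := fun y => |(P n ^ T n) x y - π n y|)
              (Set.finite_range _).bddAbove y
        _ ≤ ⨆ x, ⨆ y, |(P n ^ T n) x y - π n y| := by
            exact le_ciSup (f := fun x => ⨆ y, |(P n ^ T n) x y - π n y|)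
              (Set.finite_range _).bddAbove x
        _ ≤ (n : ℝ) ^ (-c) := by
            have h := (le_abs_self _).trans h1
            rwa [one_mul, Real.norm_of_nonneg (Real.rpow_pos_of_pos hn0 _).le] at h
        _ ≤ (n : ℝ) ^ (-2 : ℝ) := Real.rpow_le_rpow_of_exponent_le hn1 (by linarith)
        _ ≤ s * ⨅ x, π n x := h3
        _ ≤ s * π n y := mul_le_mul_of_nonneg_left (hinf_le y) hs.le
    have hsmall : ∀ x, (T n + 1) * π n x ≤ s ^ 2 := by
      intro x
      have hle : π n x ≤ ⨆ y, π n y := le_ciSup (Set.finite_range _).bddAbove x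
      have hT1 : (1 : ℝ) ≤ T n := by exact_mod_cast hTn
      have h5 : (T n : ℝ) * π n x ≤ s ^ 2 / 2 :=
        (mul_le_mul_of_nonneg_left hle (by linarith)).trans h2
      nlinarith [hpos x]
    intro x
    have : Nontrivial (S n) := Fintype.one_lt_card_iff_nontrivial.1 (by rw [hcard]; omega)
    have : Nonempty {y // y ≠ x} := nonempty_subtype.2 (exists_ne x)
    exact hXn.first_visit_bounds hPn hπn hpos hTn hs hs2 hmix x (hKn x) (hsmall x)
  -- a choice of `s` for which the error `20 * s` is below a given `ε`, which may be `⊤`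
  have hε : ∀ ε : ENNReal, 0 < ε → ∃ s : ℝ, 0 < s ∧ s ≤ 1 / 20 ∧ ENNReal.ofReal (20 * s) ≤ ε := by
    intro ε hε
    rcases eq_or_ne ε ⊤ with rfl | hne
    · exact ⟨1 / 20, by norm_num, le_rfl, le_top⟩
    · have h0 : 0 < ε.toReal := ENNReal.toReal_pos hε.ne' hne
      refine ⟨min (1 / 20) (ε.toReal / 20), lt_min (by norm_num) (by linarith),
        min_le_left _ _, ENNReal.ofReal_le_of_le_toReal ?_⟩
      linarith [min_le_right (1 / 20) (ε.toReal / 20)]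
  constructor
  · refine ENNReal.tendsto_nhds_zero.2 fun ε hε0 => ?_
    obtain ⟨s, hs, hs2, hsε⟩ := hε ε hε0
    filter_upwards [key s hs hs2] with n hn
    exact iSup_le fun x => iSup_le fun t => (ENNReal.ofReal_le_ofReal ((hn x).1 t)).trans hsε
  · refine ENNReal.tendsto_nhds_zero.2 fun ε hε0 => ?_
    obtain ⟨s, hs, hs2, hsε⟩ := hε ε hε0
    filter_upwards [key s hs hs2] with n hn
    exact iSup_le fun x => (ENNReal.ofReal_le_ofReal (hn x).2).trans hsε
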